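/- Let $w$ be a bounded probability density on $\mathbb{R}$ and let $F:\mathbb{R}\to\mathbb{R}$ be twice continuously differentiable with $F'$ and $F''$ bounded. Let $\hat u\in C^1(\mathbb{R})$ with $\hat u_x\in L^1(\mathbb{R})$ be a travelling wave profile with speed $c\in\mathbb{R}$, i.e. $$-c\,\hat u_x=-\hat u+w*F(\hat u),\qquad \lim_{x\to-\infty}\hat u(x)=0,\quad \lim_{x\to\infty}\hat u(x)=1 .$$ (Then $\hat u_x\in L^2(\mathbb{R})$ and all differences of translates of $\hat u$ belong to $L^2(\mathbb{R})$.) Let $T>0$, $\varepsilon>0$, $m>0$, let $Q$ be a symmetric nonnegative trace class operator on $L^2(\mathbb{R})$, let $W^Q$ be a $Q$-Wiener process on $L^2(\mathbb{R})$ with respect to a filtration on a probability space, and let $v_0\in L^2(\mathbb{R})$. Let $v$ be the (mild, equivalently strong) solution on $[0,T]$ of $$dv_t=\bigl[-v_t+w*\bigl(F(v_t+\hat u(\cdot-ct))-F(\hat u(\cdot-ct))\bigr)\bigr]\,dt+\sqrt{\varepsilon}\,dW^Q_t,\qquad v(0)=v_0,$$ put $u_t=\hat u(\cdot-ct)+v_t$,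 and let $C(\cdot)$ be the pathwise solution on $[0,T]$ of $$\dot C(t)=-m\,\bigl\langle \hat u_x(\cdot-ct-C(t)),\,u_t-\hat u(\cdot-ct-C(t))\bigr\rangle_{L^2},\qquad C(0)=0 .$$ With $\phi(t)=ct+C(t)$, define on $L^2(\mathbb{R})$ the ($\omega$-dependent) operators $$A^0(t)z=-z+w*\bigl(F'(\hat u(\cdot-\phi(t)))\,z\bigr),\qquad A(t)z=A^0(t)z-m\,\langle\hat u_x(\cdot-\phi(t)),z\rangle_{L^2}\,\hat u_x(\cdot-\phi(t)).$$ Assume that there are $\kappa_*>0$ and $C_*>0$ with $m>C_*$ such that almost surely, for all $t\in[0,T]$ and $z\in L^2(\mathbb{R})$, $$\langle A^0(t)z,z\rangle\le-\kappa_*\|z\|^2+C_*\langle\hat u_x(\cdot-\phi(t)),z\rangle^2 .$$ Let $Z$ be the (mild, equivalently strong) solution of $dZ_t=A(t)Z_t\,dt+dW^Q_t$, $Z_0=0$, that is, $$Z_t=\int_0^tA(s)Z_s\,ds+W^Q_t,\qquad t\in[0,T].$$ Let $\eta\in(0,\tfrac12)$ and $\xi=\|W^Q\|_{C^\eta([0,T];L^2(\mathbb{R}))}$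 (supremum norm plus $\eta$-Hölder seminorm). Then $\xi<\infty$ almost surely, and almost surely $$\sup_{t\in[0,T]}\|Z_t\|_{L^2(\mathbb{R})}\le K\,\xi$$ with a constant $K>0$ that depends only on $\kappa_*$, $\eta$, $\|F'\|_\infty$, $\|\hat u_x\|_{L^2}$ and the relaxation rate $m$; in particular $K$ does not depend on $\varepsilon$, $T$, $Q$, $v_0$ or $\omega$. -/

import Mathlib

open MeasureTheory ProbabilityTheory Set Filter Topology
open scoped NNReal ENNReal Convolution

noncomputable section

namespace NeuralField

/-- The Hilbert space `L²(ℝ)`. -/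
abbrev L2 : Type := Lp ℝ 2 (volume : Measure ℝ)

/-- The class in `L²(ℝ)` of a square-integrable function. (The value `0` for a function that is not
square integrable is never used: see the facts `memLp_…` below.) -/
def toL2 (f : ℝ → ℝ) : L2 :=
  open Classical in if h : MemLp f 2 volume then h.toLp f else 0

/-- The convolution `(w ∗ f)(x) = ∫ w(y) f(x - y) dy` on the real line. -/
def conv (w f : ℝ → ℝ) : ℝ → ℝ :=
  w ⋆[ContinuousLinearMap.lsmul ℝ ℝ, volume] f

/-! ### Deterministic data -/

/-- `w` is a bounded probability density on `ℝ`. -/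
structure IsKernel (w : ℝ → ℝ) : Prop where
  nonneg : ∀ x, 0 ≤ w x
  bounded : ∃ M, ∀ x, w x ≤ M
  integrable : Integrable w
  integral_eq_one : ∫ x, w x = 1

/-- `F` is twice continuously differentiable with bounded derivatives. -/
structure IsGain (F : ℝ → ℝ) : Prop where
  contDiff : ContDiff ℝ 2 F
  bounded_deriv : ∃ M, ∀ x, |deriv F x| ≤ M
  bounded_deriv_deriv : ∃ M, ∀ x, |deriv (deriv F) x| ≤ M

/-- `U` is a travelling wave profile with speed `c` of `∂ₜu = -u + w ∗ F(u)`, connecting the fixed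
points `0` (at `-∞`) and `1` (at `+∞`); its derivative is integrable. -/
structure IsTravellingWave (w F : ℝ → ℝ) (c : ℝ) (U : ℝ → ℝ) : Prop where
  contDiff : ContDiff ℝ 1 U
  equation : ∀ x, -c * deriv U x = -U x + conv w (fun y => F (U y)) x
  tendsto_atBot : Tendsto U atBot (𝓝 0)
  tendsto_atTop : Tendsto U atTop (𝓝 1)
  integrable_deriv : Integrable (deriv U)

/-- The translated gradient `U_x(· - a)`, as an element of `L²(ℝ)`. -/
def grad (U : ℝ → ℝ) (a : ℝ) : L2 := toL2 (fun x => deriv U (x - a))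

/-- The difference `U(· - a) - U(· - b)` of two translates, as an element of `L²(ℝ)`. -/
def shiftDiff (U : ℝ → ℝ) (a b : ℝ) : L2 := toL2 (fun x => U (x - a) - U (x - b))

/-- The drift `v ↦ -v + w ∗ (F(v + U(· - a)) - F(U(· - a)))` on `L²(ℝ)`. -/
def drift (w F U : ℝ → ℝ) (a : ℝ) (v : L2) : L2 :=
  -v + toL2 (conv w (fun x => F (v x + U (x - a)) - F (U (x - a))))

/-- The operator `A⁰ z = -z + w ∗ (F'(U(· - a)) z)` on `L²(ℝ)`, for the phase `a`. -/
def opA0 (w F U : ℝ → ℝ) (a : ℝ) (z : L2) : L2 :=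
  -z + toL2 (conv w (fun x => deriv F (U (x - a)) * z x))

/-- The operator `A z = A⁰ z - m ⟨U_x(· - a), z⟩ U_x(· - a)` on `L²(ℝ)`, for the phase `a`. -/
def opA (w F U : ℝ → ℝ) (m a : ℝ) (z : L2) : L2 :=
  opA0 w F U a z - (m * inner ℝ (grad U a) z) • grad U a

/-! ### The stochastic objects -/

/-- A covariance operator on `L²(ℝ)`: symmetric, nonnegative, and of finite trace. -/
structure IsCovariance (Q : L2 →L[ℝ] L2) : Prop where
  isPositive : Q.IsPositive
  trace : ∃ e : HilbertBasis ℕ ℝ L2, Summable (fun n => inner ℝ (Q (e n)) (e n))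

/-- `X` is adapted to `ℱ` on the time interval `[0,T]`. -/
def AdaptedOn {Ω : Type*} {mΩ : MeasurableSpace Ω} (ℱ : Filtration ℝ mΩ) (T : ℝ)
    (X : ℝ → Ω → L2) : Prop :=
  ∀ t ∈ Icc 0 T, StronglyMeasurable[ℱ t] (X t)

/-- `W` is a `Q`-Wiener process on `L²(ℝ)` with respect to `ℱ`, on the time interval `[0,T]`.
A random variable in the Hilbert space has the law `N(0, R)` if each of its scalar products with a
vector `h` has the law `N(0, ⟨R h, h⟩)`. -/
structure IsQWiener {Ω : Type*} {mΩ : MeasurableSpace Ω} (P : Measure Ω) (ℱ : Filtration ℝ mΩ)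
    (T : ℝ) (Q : L2 →L[ℝ] L2) (W : ℝ → Ω → L2) : Prop where
  zero : ∀ᵐ ω ∂P, W 0 ω = 0
  continuous : ∀ᵐ ω ∂P, ContinuousOn (fun t => W t ω) (Icc 0 T)
  adapted : AdaptedOn ℱ T W
  indep : ∀ s t, 0 ≤ s → s ≤ t → t ≤ T →
    Indep ((borel L2).comap (fun ω => W t ω - W s ω)) (ℱ s) P
  gaussian : ∀ s t, 0 ≤ s → s ≤ t → t ≤ T → ∀ h : L2,
    P.map (fun ω => inner ℝ h (W t ω - W s ω)) =
      gaussianReal 0 (Real.toNNReal ((t - s) * inner ℝ (Q h) h))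

/-- `v` solves `dv = [-v + w ∗ (F(v + U(· - ct)) - F(U(· - ct)))] dt + √ε dW`, `v(0) = v₀`,
on `[0,T]`. As the drift has no unbounded part, the mild formulation is the integral equation. -/
structure IsFluctuation {Ω : Type*} {mΩ : MeasurableSpace Ω} (P : Measure Ω) (ℱ : Filtration ℝ mΩ)
    (T : ℝ) (w F U : ℝ → ℝ) (c ε : ℝ) (v₀ : L2) (W v : ℝ → Ω → L2) : Prop where
  adapted : AdaptedOn ℱ T v
  integrable : ∀ᵐ ω ∂P,
    IntervalIntegrable (fun s => drift w F U (c * s) (v s ω)) volume 0 T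
  equation : ∀ᵐ ω ∂P, ∀ t ∈ Icc 0 T,
    v t ω = v₀ + (∫ s in (0 : ℝ)..t, drift w F U (c * s) (v s ω)) + √ε • W t ω

/-- `C` solves, path by path on `[0,T]`, the gradient-descent equation
`C'(t) = -m ⟨U_x(· - ct - C(t)), u(t) - U(· - ct - C(t))⟩`, `C(0) = 0`, for `u(t) = U(· - ct) + v(t)`,
so that `u(t) - U(· - ct - C(t)) = v(t) + (U(· - ct) - U(· - ct - C(t)))`. -/
structure IsPhase {Ω : Type*} {mΩ : MeasurableSpace Ω} (P : Measure Ω)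
    (T : ℝ) (U : ℝ → ℝ) (c m : ℝ) (v : ℝ → Ω → L2) (C : ℝ → Ω → ℝ) : Prop where
  zero : ∀ᵐ ω ∂P, C 0 ω = 0
  equation : ∀ᵐ ω ∂P, ∀ t ∈ Icc 0 T,
    HasDerivWithinAt (fun r => C r ω)
      (-m * inner ℝ (grad U (c * t + C t ω))
        (v t ω + shiftDiff U (c * t) (c * t + C t ω))) (Icc 0 T) t

/-- `Z` is a (mild, equivalently strong) solution on `[0,T]` of `dZ = A(t) Z dt + dW`, `Z(0) = 0`,
where `A(t)` is the operator `opA` for the random phase `ct + C(t)`. -/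
structure IsOrnsteinUhlenbeck {Ω : Type*} {mΩ : MeasurableSpace Ω} (P : Measure Ω)
    (ℱ : Filtration ℝ mΩ) (T : ℝ) (w F U : ℝ → ℝ) (c m : ℝ) (C : ℝ → Ω → ℝ)
    (W Z : ℝ → Ω → L2) : Prop where
  adapted : AdaptedOn ℱ T Z
  integrable : ∀ᵐ ω ∂P,
    IntervalIntegrable (fun s => opA w F U m (c * s + C s ω) (Z s ω)) volume 0 T
  equation : ∀ᵐ ω ∂P, ∀ t ∈ Icc 0 T,
    Z t ω = (∫ s in (0 : ℝ)..t, opA w F U m (c * s + C s ω) (Z s ω)) + W t ω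

/-- The norm of `C^η([0,T]; L²(ℝ))`, the sum of the supremum norm and the `η`-Hölder seminorm,
with the value `∞` if the function is not `η`-Hölder continuous on `[0,T]`. -/
def holderNorm (η : ℝ≥0) (T : ℝ) (f : ℝ → L2) : ℝ≥0∞ :=
  (⨆ t ∈ Icc 0 T, ‖f t‖ₑ) + eHolderNorm η (fun t : Icc (0 : ℝ) T => f t)

/-! ### The functions above are square integrable -/

theorem conv_apply (w f : ℝ → ℝ) (x : ℝ) : conv w f x = ∫ y, w y * f (x - y) := by
  simp [conv, convolution_def]

theorem memLp_translate {f : ℝ → ℝ} (hf : MemLp f 2 volume) (a : ℝ) :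
    MemLp (fun x => f (x - a)) 2 volume :=
  hf.comp_measurePreserving (measurePreserving_sub_right volume a)

theorem memLp_conv {w f : ℝ → ℝ} (hw : IsKernel w) (hf : MemLp f 2 volume) :
    MemLp (conv w f) 2 volume := by
  have hm : AEStronglyMeasurable (fun p : ℝ × ℝ => w p.2 * f (p.1 - p.2))
      ((volume : Measure ℝ).prod volume) :=
    hw.integrable.aestronglyMeasurable.convolution_integrand
      (ContinuousLinearMap.lsmul ℝ ℝ) hf.1
  have hmeas : AEStronglyMeasurable (conv w f) volume := by
    have := hm.integral_prod_right'
    refine this.congr (ae_of_all _ fun x => ?_)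
    simp [conv_apply]
  have hwm : AEMeasurable (fun y => ‖w y‖ₑ) volume := hw.integrable.aestronglyMeasurable.enorm
  have hw1 : ∫⁻ y, ‖w y‖ₑ = 1 := by
    have h := ofReal_integral_eq_lintegral_ofReal hw.integrable (ae_of_all _ hw.nonneg)
    rw [hw.integral_eq_one, ENNReal.ofReal_one] at h
    rw [h]
    exact lintegral_congr fun y => Real.enorm_of_nonneg (hw.nonneg y)
  refine ⟨hmeas, ?_⟩
  rw [eLpNorm_lt_top_iff_lintegral_rpow_enorm_lt_top (by norm_num) (by norm_num)]
  have hf2 : ∫⁻ x, ‖f x‖ₑ ^ (2 : ℝ) < ∞ := by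
    simpa using (eLpNorm_lt_top_iff_lintegral_rpow_enorm_lt_top (by norm_num) (by norm_num)).1 hf.2
  refine lt_of_le_of_lt ?_ hf2
  have hpt : ∀ x, ‖conv w f x‖ₑ ^ (2 : ℝ) ≤ ∫⁻ y, ‖w y‖ₑ * ‖f (x - y)‖ₑ ^ (2 : ℝ) := by
    intro x
    have hfx : AEMeasurable (fun y => ‖f (x - y)‖ₑ) volume :=
      (hf.1.comp_quasiMeasurePreserving
        (quasiMeasurePreserving_sub_left volume x)).enorm
    have h1 : ‖conv w f x‖ₑ ≤ ∫⁻ y, ‖w y‖ₑ ^ (1 / 2 : ℝ) * (‖w y‖ₑ ^ (1 / 2 : ℝ) * ‖f (x - y)‖ₑ) := by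
      rw [conv_apply]
      refine (enorm_integral_le_lintegral_enorm _).trans (le_of_eq (lintegral_congr fun y => ?_))
      rw [enorm_mul, ← mul_assoc, ← ENNReal.rpow_add_of_nonneg _ _ (by norm_num) (by norm_num)]
      norm_num
    have h2 := ENNReal.lintegral_mul_le_Lp_mul_Lq volume Real.HolderConjugate.two_two
      (hwm.pow_const (1 / 2 : ℝ)) ((hwm.pow_const (1 / 2 : ℝ)).mul hfx)
    have h3 := ENNReal.rpow_le_rpow (h1.trans h2) (by norm_num : (0 : ℝ) ≤ 2)
    refine h3.trans (le_of_eq ?_)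
    have e1 : ∀ y, (‖w y‖ₑ ^ (1 / 2 : ℝ)) ^ (2 : ℝ) = ‖w y‖ₑ := fun y => by
      rw [← ENNReal.rpow_mul]; norm_num
    simp only [Pi.mul_apply, ENNReal.mul_rpow_of_nonneg _ _ (by norm_num : (0 : ℝ) ≤ 2), e1, hw1,
      ENNReal.one_rpow, one_mul]
    rw [← ENNReal.rpow_mul]; norm_num
  have hmm : AEMeasurable (Function.uncurry fun x y => ‖w y‖ₑ * ‖f (x - y)‖ₑ ^ (2 : ℝ))
      ((volume : Measure ℝ).prod volume) := by
    have a1 : AEMeasurable (fun p : ℝ × ℝ => ‖w p.2‖ₑ) ((volume : Measure ℝ).prod volume) :=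
      hwm.comp_quasiMeasurePreserving Measure.quasiMeasurePreserving_snd
    have a2 : AEMeasurable (fun p : ℝ × ℝ => ‖f (p.1 - p.2)‖ₑ) ((volume : Measure ℝ).prod volume) :=
      (hf.1.enorm).comp_quasiMeasurePreserving
        (quasiMeasurePreserving_sub volume volume)
    exact a1.mul (a2.pow_const (2 : ℝ))
  have h2 : (2 : ℝ≥0∞).toReal = (2 : ℝ) := by norm_num
  rw [h2]
  calc ∫⁻ x, ‖conv w f x‖ₑ ^ (2 : ℝ)
      ≤ ∫⁻ x, ∫⁻ y, ‖w y‖ₑ * ‖f (x - y)‖ₑ ^ (2 : ℝ) := lintegral_mono hpt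
    _ = ∫⁻ y, ∫⁻ x, ‖w y‖ₑ * ‖f (x - y)‖ₑ ^ (2 : ℝ) := lintegral_lintegral_swap hmm
    _ = ∫⁻ y, ‖w y‖ₑ * ∫⁻ x, ‖f x‖ₑ ^ (2 : ℝ) := by
        refine lintegral_congr fun y => ?_
        rw [lintegral_const_mul' _ _ enorm_ne_top,
          lintegral_sub_right_eq_self (fun x => ‖f x‖ₑ ^ (2 : ℝ)) y]
    _ = ∫⁻ x, ‖f x‖ₑ ^ (2 : ℝ) := by
        rw [lintegral_mul_const' _ _ hf2.ne, hw1, one_mul]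

theorem IsTravellingWave.sub_eq {w F U : ℝ → ℝ} {c : ℝ} (hU : IsTravellingWave w F c U) (x y : ℝ) :
    U y - U x = ∫ s in x..y, deriv U s :=
  (intervalIntegral.integral_deriv_eq_sub
    (fun s _ => (hU.contDiff.differentiable one_ne_zero) s)
    (hU.integrable_deriv.intervalIntegrable)).symm

theorem IsTravellingWave.bounded {w F U : ℝ → ℝ} {c : ℝ} (hU : IsTravellingWave w F c U) :
    ∃ M, ∀ x, |U x| ≤ M := by
  refine ⟨|U 0| + ∫ s, |deriv U s|, fun x => ?_⟩
  have h : |U x - U 0| ≤ ∫ s, |deriv U s| := by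
    rw [hU.sub_eq 0 x]
    refine (intervalIntegral.norm_integral_le_integral_norm_uIoc (μ := volume) (f := deriv U)).trans ?_
    exact setIntegral_le_integral hU.integrable_deriv.norm (ae_of_all _ fun s => norm_nonneg _)
  have h1 : |U x| ≤ |U 0| + |U x - U 0| := by
    have := abs_add_le (U 0) (U x - U 0)
    simpa using this
  linarith

theorem IsTravellingWave.lintegral_shift_le {w F U : ℝ → ℝ} {c : ℝ}
    (hU : IsTravellingWave w F c U) (a b : ℝ) :
    ∫⁻ x, ‖U (x - a) - U (x - b)‖ₑ ≤ ENNReal.ofReal |a - b| * ∫⁻ x, ‖deriv U x‖ₑ := by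
  have hc : Continuous (deriv U) := hU.contDiff.continuous_deriv le_rfl
  have h1 : ∀ x, ‖U (x - a) - U (x - b)‖ₑ ≤ ∫⁻ s in uIoc (-b) (-a), ‖deriv U (x + s)‖ₑ := by
    intro x
    have e : U (x - a) - U (x - b) = ∫ s in (-b)..(-a), deriv U (x + s) := by
      rw [hU.sub_eq (x - b) (x - a), intervalIntegral.integral_comp_add_left (deriv U) x]
      simp [sub_eq_add_neg]
    have e2 : ‖U (x - a) - U (x - b)‖ₑ = ‖∫ s in uIoc (-b) (-a), deriv U (x + s)‖ₑ := by
      rw [e, ← ofReal_norm, ← ofReal_norm, intervalIntegral.norm_intervalIntegral_eq]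
    rw [e2]
    exact enorm_integral_le_lintegral_enorm _
  calc ∫⁻ x, ‖U (x - a) - U (x - b)‖ₑ
      ≤ ∫⁻ x, ∫⁻ s in uIoc (-b) (-a), ‖deriv U (x + s)‖ₑ := lintegral_mono h1
    _ = ∫⁻ s in uIoc (-b) (-a), ∫⁻ x, ‖deriv U (x + s)‖ₑ := by
        refine lintegral_lintegral_swap ?_
        exact (hc.comp (continuous_fst.add continuous_snd)).enorm.measurable.aemeasurable
    _ = ∫⁻ _ in uIoc (-b) (-a), ∫⁻ x, ‖deriv U x‖ₑ := by
        refine lintegral_congr fun s => ?_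
        exact lintegral_add_right_eq_self (fun x => ‖deriv U x‖ₑ) s
    _ = ENNReal.ofReal |a - b| * ∫⁻ x, ‖deriv U x‖ₑ := by
        rw [setLIntegral_const, mul_comm, Real.volume_uIoc, abs_sub_comm a b]
        congr 3
        ring

theorem IsTravellingWave.integrable_shift {w F U : ℝ → ℝ} {c : ℝ}
    (hU : IsTravellingWave w F c U) (a b : ℝ) :
    Integrable (fun x => U (x - a) - U (x - b)) := by
  have hc : Continuous U := hU.contDiff.continuous
  refine ⟨Continuous.aestronglyMeasurable (by fun_prop), ?_⟩
  exact (hU.lintegral_shift_le a b).trans_lt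
    (ENNReal.mul_lt_top ENNReal.ofReal_lt_top hU.integrable_deriv.2)

theorem IsTravellingWave.integral_shift_le {w F U : ℝ → ℝ} {c : ℝ}
    (hU : IsTravellingWave w F c U) (a b : ℝ) :
    ∫ x, |U (x - a) - U (x - b)| ≤ |a - b| * ∫ x, |deriv U x| := by
  have e1 := integral_norm_eq_lintegral_enorm (hU.integrable_shift a b).1
  have e2 := integral_norm_eq_lintegral_enorm hU.integrable_deriv.1
  simp only [Real.norm_eq_abs] at e1 e2
  rw [e1, e2, ← ENNReal.toReal_ofReal (abs_nonneg (a - b)), ← ENNReal.toReal_mul]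
  exact ENNReal.toReal_mono
    (ENNReal.mul_lt_top ENNReal.ofReal_lt_top hU.integrable_deriv.2).ne (hU.lintegral_shift_le a b)

theorem IsGain.lipschitz {F : ℝ → ℝ} (hF : IsGain F) :
    ∃ L, 0 ≤ L ∧ ∀ x y, |F x - F y| ≤ L * |x - y| := by
  obtain ⟨M, hM⟩ := hF.bounded_deriv
  refine ⟨M, (abs_nonneg _).trans (hM 0), fun x y => ?_⟩
  exact convex_univ.norm_image_sub_le_of_norm_deriv_le
    (fun z _ => (hF.contDiff.differentiable two_ne_zero) z) (fun z _ => hM z)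
    (mem_univ y) (mem_univ x)

theorem IsKernel.abs_conv_le {w f : ℝ → ℝ} (hw : IsKernel w) {B : ℝ} (hf : ∀ x, |f x| ≤ B) (x : ℝ) :
    |conv w f x| ≤ B := by
  rw [conv_apply]
  have h := norm_integral_le_of_norm_le (μ := volume) (f := fun y => w y * f (x - y))
    (hw.integrable.mul_const B) (ae_of_all _ fun y => by
      rw [norm_mul, Real.norm_of_nonneg (hw.nonneg y)]
      exact mul_le_mul_of_nonneg_left (hf _) (hw.nonneg y))
  rwa [integral_mul_const, hw.integral_eq_one, one_mul] at h

theorem IsTravellingWave.bounded_deriv {w F U : ℝ → ℝ} {c : ℝ} (hw : IsKernel w) (hF : IsGain F)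
    (hU : IsTravellingWave w F c U) : ∃ M, ∀ x, |deriv U x| ≤ M := by
  obtain ⟨M, hM⟩ := hU.bounded
  obtain ⟨L, hL0, hL⟩ := hF.lipschitz
  have hM0 : 0 ≤ M := (abs_nonneg _).trans (hM 0)
  have hFU : ∀ x, |F (U x)| ≤ |F 0| + L * M := fun x => by
    have h1 := hL (U x) 0
    have h2 := abs_add_le (F 0) (F (U x) - F 0)
    rw [add_sub_cancel] at h2
    rw [sub_zero] at h1
    have := mul_le_mul_of_nonneg_left (hM x) hL0
    linarith
  have hcU : Continuous U := hU.contDiff.continuous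
  have hcF : Continuous F := hF.contDiff.continuous
  by_cases hc : c = 0
  · obtain ⟨N, hN⟩ := hw.bounded
    have hN0 : 0 ≤ N := (hw.nonneg 0).trans (hN 0)
    have hfix : ∀ x, U x = ∫ y, w y * F (U (x - y)) := fun x => by
      have := hU.equation x
      rw [hc, conv_apply] at this
      linarith
    have hint : ∀ x, Integrable (fun y => w y * F (U (x - y))) := fun x =>
      hw.integrable.mul_bdd (c := |F 0| + L * M) (Continuous.aestronglyMeasurable (by fun_prop))
        (ae_of_all _ fun y => hFU _)
    have hD0 : 0 ≤ ∫ s, |deriv U s| := integral_nonneg fun s => abs_nonneg _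
    have hlip : ∀ x x', |U x - U x'| ≤ N * L * (∫ s, |deriv U s|) * |x - x'| := by
      intro x x'
      have hsh : Integrable (fun y => U (x - y) - U (x' - y)) := by
        have := (hU.integrable_shift 0 (x - x')).comp_sub_left x
        refine this.congr (ae_of_all _ fun y => ?_)
        simp only [sub_zero]
        congr 2
        ring
      have hshi : ∫ y, |U (x - y) - U (x' - y)| ≤ |x - x'| * ∫ s, |deriv U s| := by
        have h1 := hU.integral_shift_le 0 (x - x')
        rw [← integral_sub_left_eq_self
          (fun y => |U (y - 0) - U (y - (x - x'))|) volume x] at h1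
        rw [zero_sub, abs_neg] at h1
        refine le_trans (le_of_eq ?_) h1
        refine integral_congr_ae (ae_of_all _ fun y => ?_)
        simp only [sub_zero]
        congr 3
        ring
      have e : U x - U x' = ∫ y, (w y * F (U (x - y)) - w y * F (U (x' - y))) := by
        rw [integral_sub (hint x) (hint x'), ← hfix, ← hfix]
      have h2 := norm_integral_le_of_norm_le (μ := volume)
        (f := fun y => w y * F (U (x - y)) - w y * F (U (x' - y)))
        (hsh.abs.const_mul (N * L)) (ae_of_all _ fun y => by
          rw [← mul_sub, norm_mul, Real.norm_of_nonneg (hw.nonneg y), mul_assoc]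
          exact mul_le_mul (hN y) (hL _ _) (abs_nonneg _) hN0)
      rw [← e, integral_const_mul] at h2
      refine h2.trans ?_
      have := mul_le_mul_of_nonneg_left hshi (mul_nonneg hN0 hL0)
      linarith
    have hl : LipschitzWith (Real.toNNReal (N * L * ∫ s, |deriv U s|)) U := by
      refine LipschitzWith.of_dist_le_mul fun x x' => ?_
      rw [Real.coe_toNNReal _ (by positivity), Real.dist_eq, Real.dist_eq]
      exact hlip x x'
    exact ⟨_, fun x => norm_deriv_le_of_lipschitz hl⟩
  · refine ⟨(M + (|F 0| + L * M)) / |c|, fun x => ?_⟩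
    rw [le_div_iff₀ (abs_pos.2 hc), ← abs_mul]
    have h1 := hU.equation x
    have h2 : deriv U x * c = U x - conv w (fun y => F (U y)) x := by linarith
    rw [h2]
    exact (abs_sub _ _).trans (add_le_add (hM x) (hw.abs_conv_le hFU x))

theorem memLp_two_of_bounded {f : ℝ → ℝ} (hf : Integrable f) {M : ℝ} (hM : ∀ x, |f x| ≤ M) :
    MemLp f 2 volume := by
  rw [memLp_two_iff_integrable_sq hf.1]
  have := hf.mul_bdd (c := M) hf.1 (ae_of_all _ fun x => hM x)
  simpa [sq] using this

theorem memLp_linear {w F U : ℝ → ℝ} {c : ℝ} (hw : IsKernel w) (hF : IsGain F)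
    (hU : IsTravellingWave w F c U) (a : ℝ) (z : L2) :
    MemLp (conv w (fun x => deriv F (U (x - a)) * z x)) 2 volume := by
  obtain ⟨M, hM⟩ := hF.bounded_deriv
  have hcU : Continuous U := hU.contDiff.continuous
  have hcF : Continuous (deriv F) := hF.contDiff.continuous_deriv (by norm_num)
  refine memLp_conv hw ((Lp.memLp z).of_le_mul (c := M) ?_ (ae_of_all _ fun x => ?_))
  · exact (Continuous.aestronglyMeasurable (by fun_prop)).mul (Lp.memLp z).1
  · rw [norm_mul]
    exact mul_le_mul_of_nonneg_right (hM _) (norm_nonneg _)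

theorem memLp_drift {w F U : ℝ → ℝ} {c : ℝ} (hw : IsKernel w) (hF : IsGain F)
    (hU : IsTravellingWave w F c U) (a : ℝ) (v : L2) :
    MemLp (conv w (fun x => F (v x + U (x - a)) - F (U (x - a)))) 2 volume := by
  obtain ⟨L, -, hL⟩ := hF.lipschitz
  have hcU : Continuous (fun x => U (x - a)) := hU.contDiff.continuous.comp (by fun_prop)
  have hcF : Continuous F := hF.contDiff.continuous
  refine memLp_conv hw ((Lp.memLp v).of_le_mul (c := L) ?_ (ae_of_all _ fun x => ?_))
  · exact (hcF.comp_aestronglyMeasurable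
      ((Lp.memLp v).1.add hcU.aestronglyMeasurable)).sub
      (hcF.comp hcU).aestronglyMeasurable
  · simpa using hL (v x + U (x - a)) (U (x - a))

theorem memLp_grad {w F U : ℝ → ℝ} {c : ℝ} (hw : IsKernel w) (hF : IsGain F)
    (hU : IsTravellingWave w F c U) (a : ℝ) :
    MemLp (fun x => deriv U (x - a)) 2 volume := by
  obtain ⟨M, hM⟩ := hU.bounded_deriv hw hF
  exact memLp_translate (memLp_two_of_bounded hU.integrable_deriv hM) a

theorem memLp_shiftDiff {w F U : ℝ → ℝ} {c : ℝ}
    (hU : IsTravellingWave w F c U) (a b : ℝ) :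
    MemLp (fun x => U (x - a) - U (x - b)) 2 volume := by
  obtain ⟨M, hM⟩ := hU.bounded
  exact memLp_two_of_bounded (hU.integrable_shift a b) (M := M + M) fun x =>
    (abs_sub _ _).trans (add_le_add (hM _) (hM _))

end NeuralField

end

open NeuralField

open NeuralField

/-! ### The drift operators -/

/-! The bound on `Z` is deterministic, path by path. Put `Y = Z - W`, which is the integral of `A(s)
Z_s`. The operators satisfy `‖A z‖ ≤ L ‖z‖` with `L = 1 + ‖F'‖_∞ + m ‖U_x‖²`, because convolution
with `w` is a contraction and translation preserves the `L²` norm (`norm_opA_le`); and `⟨A z, z⟩ ≤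
-κ ‖z‖²`, because the relaxation term with `m > C_*` absorbs the unstable direction
(`inner_opA_le`). If `‖W‖ ≤ ξ`, then `⟨Y, A Z⟩ = ⟨Z, A Z⟩ - ⟨W, A Z⟩ ≤ -‖Z‖ (κ ‖Z‖ - L ξ)`, which is
nonpositive once `‖Y‖ > (1 + L/κ) ξ`. So `Y` cannot leave the ball of that radius
(`norm_integral_le_of_inner_nonpos`), and `‖Z‖ ≤ (2 + L/κ) ξ` (`norm_le_of_dissipative`). Only the
supremum part of the Hölder norm enters this bound.

Finiteness of the Hölder norm is Kolmogorov's argument. The moments of order `2p` of an increment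
over a time `h` are at most a constant times `h ^ p`, by finite trace
(`IsQWiener.exists_lintegral_le`). For `p (1 - 2η) > 1` the weighted dyadic moments are summable
(`IsQWiener.ae_exists_dyadic_bound`), and chaining extends the dyadic bound to all times
(`norm_sub_le_of_dyadic`). -/

theorem enorm_toL2 {f : ℝ → ℝ} (hf : MemLp f 2 volume) :
    ‖toL2 f‖ₑ = eLpNorm f 2 volume := by
  rw [toL2, dif_pos hf, Lp.enorm_toLp]

/-- Convolution with a probability density is a contraction of `L²(ℝ)`. -/
theorem eLpNorm_conv_le {w f : ℝ → ℝ} (hw : IsKernel w) (hf : MemLp f 2 volume) :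
    eLpNorm (conv w f) 2 volume ≤ eLpNorm f 2 volume := by
  have hwm : AEMeasurable (fun y => ‖w y‖ₑ) volume := hw.integrable.aestronglyMeasurable.enorm
  have hw1 : ∫⁻ y, ‖w y‖ₑ = 1 := by
    have h := ofReal_integral_eq_lintegral_ofReal hw.integrable (ae_of_all _ hw.nonneg)
    rw [hw.integral_eq_one, ENNReal.ofReal_one] at h
    rw [h]
    exact lintegral_congr fun y => Real.enorm_of_nonneg (hw.nonneg y)
  have hpt : ∀ x, ‖conv w f x‖ₑ ^ (2 : ℝ) ≤ ∫⁻ y, ‖w y‖ₑ * ‖f (x - y)‖ₑ ^ (2 : ℝ) := by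
    intro x
    have hfx : AEMeasurable (fun y => ‖f (x - y)‖ₑ) volume :=
      (hf.1.comp_quasiMeasurePreserving (quasiMeasurePreserving_sub_left volume x)).enorm
    -- Splitting `w` into two square roots prepares Cauchy-Schwarz: one factor integrates to the
    -- total mass `1`.
    have h1 : ‖conv w f x‖ₑ ≤
        ∫⁻ y, ‖w y‖ₑ ^ (1 / 2 : ℝ) * (‖w y‖ₑ ^ (1 / 2 : ℝ) * ‖f (x - y)‖ₑ) := by
      rw [conv_apply]
      refine (enorm_integral_le_lintegral_enorm _).trans (le_of_eq (lintegral_congr fun y => ?_))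
      rw [enorm_mul, ← mul_assoc, ← ENNReal.rpow_add_of_nonneg _ _ (by norm_num) (by norm_num)]
      norm_num
    have h2 := ENNReal.lintegral_mul_le_Lp_mul_Lq volume Real.HolderConjugate.two_two
      (hwm.pow_const (1 / 2 : ℝ)) ((hwm.pow_const (1 / 2 : ℝ)).mul hfx)
    refine (ENNReal.rpow_le_rpow (h1.trans h2) (by norm_num : (0 : ℝ) ≤ 2)).trans (le_of_eq ?_)
    have e1 : ∀ y, (‖w y‖ₑ ^ (1 / 2 : ℝ)) ^ (2 : ℝ) = ‖w y‖ₑ := fun y => by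
      rw [← ENNReal.rpow_mul]; norm_num
    simp only [Pi.mul_apply, ENNReal.mul_rpow_of_nonneg _ _ (by norm_num : (0 : ℝ) ≤ 2), e1, hw1,
      ENNReal.one_rpow, one_mul]
    rw [← ENNReal.rpow_mul]; norm_num
  have hmm : AEMeasurable (Function.uncurry fun x y => ‖w y‖ₑ * ‖f (x - y)‖ₑ ^ (2 : ℝ))
      ((volume : Measure ℝ).prod volume) := by
    have a1 : AEMeasurable (fun p : ℝ × ℝ => ‖w p.2‖ₑ) ((volume : Measure ℝ).prod volume) :=
      hwm.comp_quasiMeasurePreserving Measure.quasiMeasurePreserving_snd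
    have a2 : AEMeasurable (fun p : ℝ × ℝ => ‖f (p.1 - p.2)‖ₑ) ((volume : Measure ℝ).prod volume) :=
      hf.1.enorm.comp_quasiMeasurePreserving (quasiMeasurePreserving_sub volume volume)
    exact a1.mul (a2.pow_const (2 : ℝ))
  rw [eLpNorm_eq_lintegral_rpow_enorm_toReal (by norm_num) (by norm_num),
    eLpNorm_eq_lintegral_rpow_enorm_toReal (by norm_num) (by norm_num)]
  refine ENNReal.rpow_le_rpow ?_ (by norm_num)
  have h2 : (2 : ℝ≥0∞).toReal = (2 : ℝ) := by norm_num
  rw [h2]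
  calc ∫⁻ x, ‖conv w f x‖ₑ ^ (2 : ℝ)
      ≤ ∫⁻ x, ∫⁻ y, ‖w y‖ₑ * ‖f (x - y)‖ₑ ^ (2 : ℝ) := lintegral_mono hpt
    _ = ∫⁻ y, ∫⁻ x, ‖w y‖ₑ * ‖f (x - y)‖ₑ ^ (2 : ℝ) := lintegral_lintegral_swap hmm
    _ = ∫⁻ y, ‖w y‖ₑ * ∫⁻ x, ‖f x‖ₑ ^ (2 : ℝ) := by
        refine lintegral_congr fun y => ?_
        rw [lintegral_const_mul' _ _ enorm_ne_top,
          lintegral_sub_right_eq_self (fun x => ‖f x‖ₑ ^ (2 : ℝ)) y]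
    _ = ∫⁻ x, ‖f x‖ₑ ^ (2 : ℝ) := by
        rw [lintegral_mul_const'' _ hwm, hw1, one_mul]

/-- Lebesgue measure is translation invariant. This removes the random phase from the growth
constant. -/
theorem norm_grad {w F U : ℝ → ℝ} {c : ℝ} (hw : IsKernel w) (hF : IsGain F)
    (hU : IsTravellingWave w F c U) (a : ℝ) : ‖grad U a‖ = ‖grad U 0‖ := by
  have key : ‖grad U a‖ₑ = ‖grad U 0‖ₑ := by
    rw [grad, grad, enorm_toL2 (memLp_grad hw hF hU a), enorm_toL2 (memLp_grad hw hF hU 0)]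
    have h0 := memLp_grad hw hF hU 0
    have := eLpNorm_comp_measurePreserving (p := 2) h0.1 (measurePreserving_sub_right volume a)
    rw [← this]
    simp [Function.comp_def]
  simpa [enorm_eq_iff_norm_eq] using key

theorem norm_opA0_le {w F U : ℝ → ℝ} {c : ℝ} (hw : IsKernel w) (hF : IsGain F)
    (hU : IsTravellingWave w F c U) (a : ℝ) (z : L2) :
    ‖opA0 w F U a z‖ ≤ (1 + ⨆ x, |deriv F x|) * ‖z‖ := by
  set L := ⨆ x, |deriv F x|
  have hL : ∀ x, |deriv F x| ≤ L := by
    obtain ⟨M, hM⟩ := hF.bounded_deriv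
    exact le_ciSup ⟨M, by rintro _ ⟨x, rfl⟩; exact hM x⟩
  have hL0 : 0 ≤ L := (abs_nonneg _).trans (hL 0)
  have hcU : Continuous U := hU.contDiff.continuous
  have hcF : Continuous (deriv F) := hF.contDiff.continuous_deriv (by norm_num)
  have hpt : ∀ x, ‖deriv F (U (x - a)) * z x‖ ≤ L * ‖z x‖ := fun x => by
    rw [norm_mul]
    exact mul_le_mul_of_nonneg_right (hL _) (norm_nonneg _)
  have hf : MemLp (fun x => deriv F (U (x - a)) * z x) 2 volume :=
    (Lp.memLp z).of_le_mul (c := L)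
      ((Continuous.aestronglyMeasurable (by fun_prop)).mul (Lp.memLp z).1) (ae_of_all _ hpt)
  have h1 : ‖toL2 (conv w (fun x => deriv F (U (x - a)) * z x))‖ₑ ≤ ENNReal.ofReal L * ‖z‖ₑ := by
    rw [enorm_toL2 (memLp_conv hw hf), Lp.enorm_def]
    exact (eLpNorm_conv_le hw hf).trans (eLpNorm_le_mul_eLpNorm_of_ae_le_mul (ae_of_all _ hpt) 2)
  have h2 : ‖toL2 (conv w (fun x => deriv F (U (x - a)) * z x))‖ ≤ L * ‖z‖ := by
    rw [← ofReal_norm, ← ofReal_norm, ← ENNReal.ofReal_mul hL0] at h1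
    exact (ENNReal.ofReal_le_ofReal_iff (by positivity)).1 h1
  calc ‖opA0 w F U a z‖ ≤ ‖-z‖ + ‖toL2 (conv w (fun x => deriv F (U (x - a)) * z x))‖ :=
        norm_add_le _ _
    _ ≤ (1 + L) * ‖z‖ := by rw [norm_neg]; linarith

theorem norm_opA_le {w F U : ℝ → ℝ} {c m : ℝ} (hw : IsKernel w) (hF : IsGain F)
    (hU : IsTravellingWave w F c U) (hm : 0 ≤ m) (a : ℝ) (z : L2) :
    ‖opA w F U m a z‖ ≤ (1 + (⨆ x, |deriv F x|) + m * ‖grad U 0‖ ^ 2) * ‖z‖ := by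
  have h1 := norm_opA0_le hw hF hU a z
  have h2 : ‖(m * inner ℝ (grad U a) z) • grad U a‖ ≤ m * ‖grad U 0‖ ^ 2 * ‖z‖ := by
    rw [norm_smul, norm_mul, Real.norm_of_nonneg hm]
    have := norm_inner_le_norm (𝕜 := ℝ) (grad U a) z
    calc m * ‖inner ℝ (grad U a) z‖ * ‖grad U a‖
        ≤ m * (‖grad U a‖ * ‖z‖) * ‖grad U a‖ := by gcongr
      _ = m * ‖grad U 0‖ ^ 2 * ‖z‖ := by rw [norm_grad hw hF hU a]; ring
  have h3 := norm_sub_le (opA0 w F U a z) ((m * inner ℝ (grad U a) z) • grad U a)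
  rw [opA]
  linarith

/-- The rank-one term contributes `-m ⟨U_x, z⟩²`, which outweighs the defect `C ⟨U_x, z⟩²`. -/
theorem inner_opA_le {w F U : ℝ → ℝ} {κ m C a : ℝ} {z : L2} (hC : C ≤ m)
    (h : inner ℝ (opA0 w F U a z) z ≤ -κ * ‖z‖ ^ 2 + C * (inner ℝ (grad U a) z) ^ 2) :
    inner ℝ (opA w F U m a z) z ≤ -κ * ‖z‖ ^ 2 := by
  rw [opA, inner_sub_left, real_inner_smul_left]
  nlinarith [mul_nonneg (sub_nonneg.2 hC) (sq_nonneg (inner ℝ (grad U a) z : ℝ))]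

/-! ### An energy estimate -/

/-- An integral curve that does not move outwards where its norm exceeds `R`, starting at the
origin, stays in the ball of radius `R`. -/
theorem norm_integral_le_of_inner_nonpos {E : Type*} [NormedAddCommGroup E]
    [InnerProductSpace ℝ E] [CompleteSpace E] {T R G : ℝ} {g : ℝ → E} (hR : 0 ≤ R)
    (hg : IntervalIntegrable g volume 0 T) (hG : ∀ s ∈ Icc 0 T, ‖g s‖ ≤ G)
    (hin : ∀ s ∈ Icc 0 T, R < ‖∫ r in (0 : ℝ)..s, g r‖ → inner ℝ (∫ r in (0 : ℝ)..s, g r) (g s) ≤ 0) :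
    ∀ t ∈ Icc 0 T, ‖∫ r in (0 : ℝ)..t, g r‖ ≤ R := by
  set Y : ℝ → E := fun t => ∫ r in (0 : ℝ)..t, g r with hY
  intro t₁ ht₁
  by_contra! hlt
  have hT : 0 ≤ T := ht₁.1.trans ht₁.2
  have hG0 : 0 ≤ G := (norm_nonneg _).trans (hG 0 ⟨le_rfl, hT⟩)
  have hgi : ∀ s ∈ Icc 0 T, ∀ t ∈ Icc 0 T, IntervalIntegrable g volume s t := fun s hs t ht =>
    hg.mono_set (by rw [uIcc_of_le hT]; exact uIcc_subset_Icc hs ht)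
  have hlip : LipschitzOnWith G.toNNReal Y (Icc 0 T) := by
    refine LipschitzOnWith.of_dist_le_mul fun s hs t ht => ?_
    rw [Real.coe_toNNReal _ hG0, dist_eq_norm, Real.dist_eq]
    have e : Y s - Y t = ∫ r in t..s, g r := by
      rw [hY, intervalIntegral.integral_interval_sub_left]
      · exact hgi _ ⟨le_rfl, hT⟩ _ hs
      · exact hgi _ ⟨le_rfl, hT⟩ _ ht
    rw [e]
    refine intervalIntegral.norm_integral_le_of_norm_le_const fun r hr => hG r ?_
    exact uIcc_subset_Icc ht hs (uIoc_subset_uIcc hr)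
  have hYc : ContinuousOn Y (Icc 0 T) := hlip.continuousOn
  set S := {s ∈ Icc 0 t₁ | ‖Y s‖ ≤ R} with hS
  have hsub : Icc 0 t₁ ⊆ Icc 0 T := Icc_subset_Icc_right ht₁.2
  have hSc : IsCompact S := by
    have : S = Icc 0 t₁ ∩ (fun s => ‖Y s‖) ⁻¹' Iic R := rfl
    rw [this]
    exact isCompact_Icc.of_isClosed_subset
      ((hYc.mono hsub).norm.preimage_isClosed_of_isClosed isClosed_Icc isClosed_Iic)
      inter_subset_left
  have h0S : (0 : ℝ) ∈ S := ⟨⟨le_rfl, ht₁.1⟩, by simpa [hY] using hR⟩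
  -- `t₀` is the last time up to `t₁` at which the curve is in the ball.
  obtain ⟨t₀, ⟨ht₀, ht₀R⟩, hmax⟩ := hSc.exists_isMaxOn ⟨0, h0S⟩ continuousOn_id
  have hout : ∀ s ∈ Ioc t₀ t₁, R < ‖Y s‖ := by
    intro s hs
    by_contra! hle
    have : s ≤ t₀ := hmax (show s ∈ S from ⟨⟨ht₀.1.trans hs.1.le, hs.2⟩, hle⟩)
    exact absurd hs.1 (not_lt.2 this)
  -- As `g` is only integrable, `Y` is differentiable merely almost everywhere. Absolute continuity
  -- of `‖Y‖²` still allows its derivative, nonpositive a.e. on `(t₀, t₁]`, to be integrated.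
  have hac : AbsolutelyContinuousOnInterval (fun s => ‖Y s‖ * ‖Y s‖) t₀ t₁ := by
    have hn : AbsolutelyContinuousOnInterval (fun s => ‖Y s‖) t₀ t₁ := by
      refine LipschitzOnWith.absolutelyContinuousOnInterval (K := 1 * G.toNNReal) ?_
      refine (lipschitzWith_one_norm.comp_lipschitzOnWith hlip).mono ?_
      exact uIcc_subset_Icc (hsub ht₀) ht₁
    exact hn.mul hn
  have hint := hac.integral_deriv_eq_sub
  have hle : ∫ s in t₀..t₁, deriv (fun s => ‖Y s‖ * ‖Y s‖) s ≤ 0 := by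
    rw [intervalIntegral.integral_of_le ht₀.2]
    refine integral_nonpos_of_ae ((ae_restrict_iff' measurableSet_Ioc).2 ?_)
    filter_upwards [hg.ae_hasDerivAt_integral] with s hs hst
    have hsT : s ∈ Icc 0 T := hsub ⟨ht₀.1.trans hst.1.le, hst.2⟩
    have hd : HasDerivAt Y (g s) s :=
      hs (by rwa [uIcc_of_le hT]) 0 left_mem_uIcc
    have hd2 := hd.norm_sq
    simp only [← sq]
    rw [hd2.deriv]
    have := hin s hsT (hout s hst)
    simp only [Pi.zero_apply]
    linarith
  rw [hint] at hle
  nlinarith [norm_nonneg (Y t₀)]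

/-! ### Hölder continuity from dyadic increments -/

section Dyadic

variable {E : Type*} [NormedAddCommGroup E] {f : ℝ → E} {B r : ℝ}

theorem floor_two_pow_div_le (n : ℕ) {x : ℝ} (hx : 0 ≤ x) : (⌊2 ^ n * x⌋₊ : ℝ) / 2 ^ n ≤ x := by
  rw [div_le_iff₀ (by positivity), mul_comm x]
  exact Nat.floor_le (by positivity)

theorem floor_two_pow_div_mem (n : ℕ) {x : ℝ} (hx : x ∈ Icc (0 : ℝ) 1) :
    (⌊2 ^ n * x⌋₊ : ℝ) / 2 ^ n ∈ Icc (0 : ℝ) 1 :=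
  ⟨by positivity, (floor_two_pow_div_le n hx.1).trans hx.2⟩

theorem tendsto_floor_two_pow_div {x : ℝ} (hx : 0 ≤ x) :
    Tendsto (fun n : ℕ => (⌊2 ^ n * x⌋₊ : ℝ) / 2 ^ n) atTop (𝓝 x) := by
  have h0 : Tendsto (fun n : ℕ => x - (1 / 2 : ℝ) ^ n) atTop (𝓝 x) := by
    simpa using tendsto_const_nhds.sub
      (tendsto_pow_atTop_nhds_zero_of_lt_one (by norm_num : (0 : ℝ) ≤ 1 / 2) (by norm_num))
  refine tendsto_of_tendsto_of_tendsto_of_le_of_le h0 tendsto_const_nhds (fun n => ?_)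
    (fun n => floor_two_pow_div_le n hx)
  have h := Nat.lt_floor_add_one (2 ^ n * x)
  have h2 : (0 : ℝ) < 2 ^ n := by positivity
  rw [le_div_iff₀ h2, sub_mul, ← mul_pow]
  norm_num
  linarith

/-- Increments between neighbouring points of the dyadic grid of mesh `2⁻ⁿ`. -/
theorem norm_sub_floor_le (hB : ∀ n k : ℕ, k < 2 ^ n →
      ‖f ((k + 1 : ℕ) / 2 ^ n) - f ((k : ℕ) / 2 ^ n)‖ ≤ B * r ^ n)
    (n : ℕ) {j k : ℕ} (hjk : j ≤ k) (hkj : k ≤ j + 1) (hk : k ≤ 2 ^ n) (h0 : 0 ≤ B * r ^ n) :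
    ‖f ((k : ℕ) / 2 ^ n) - f ((j : ℕ) / 2 ^ n)‖ ≤ B * r ^ n := by
  obtain rfl | rfl : k = j ∨ k = j + 1 := by omega
  · simpa using h0
  · exact hB n j (by omega)

/-- Chaining: `x` is the limit of its dyadic roundings, and consecutive roundings coincide or are
neighbours on the finer grid, so the passage from level `n` to `x` costs a geometric tail. At level
`n` the roundings of `s` and `t` coincide or are neighbours. -/
theorem norm_sub_le_of_dyadic (hf : ContinuousOn f (Icc 0 1)) (hB0 : 0 ≤ B) (hr0 : 0 ≤ r)
    (hr : r < 1)
    (hB : ∀ n k : ℕ, k < 2 ^ n →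
      ‖f ((k + 1 : ℕ) / 2 ^ n) - f ((k : ℕ) / 2 ^ n)‖ ≤ B * r ^ n)
    (n : ℕ) {s t : ℝ} (hs : 0 ≤ s) (hst : s ≤ t) (ht : t ≤ 1) (hd : t - s ≤ (1 / 2) ^ n) :
    ‖f t - f s‖ ≤ 3 * B / (1 - r) * r ^ n := by
  have hr1 : 0 < 1 - r := by linarith
  have hfl : ∀ x ∈ Icc (0 : ℝ) 1, ∀ k : ℕ, ⌊2 ^ k * x⌋₊ ≤ 2 ^ k := fun x hx k => by
    refine Nat.floor_le_of_le ?_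
    push_cast
    exact mul_le_of_le_one_right (by positivity) hx.2
  have hstep : ∀ x ∈ Icc (0 : ℝ) 1, ∀ k : ℕ,
      dist (f ((⌊2 ^ k * x⌋₊ : ℝ) / 2 ^ k)) (f ((⌊2 ^ (k + 1) * x⌋₊ : ℝ) / 2 ^ (k + 1)))
        ≤ B * r * r ^ k := by
    intro x hx k
    have h2x : 0 ≤ 2 ^ k * x := mul_nonneg (by positivity) hx.1
    -- The coarse point is an even point of the next grid.
    have e : (⌊2 ^ k * x⌋₊ : ℝ) / 2 ^ k = ((2 * ⌊2 ^ k * x⌋₊ : ℕ) : ℝ) / 2 ^ (k + 1) := by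
      push_cast
      rw [pow_succ]
      field_simp
    have h1 : 2 * ⌊2 ^ k * x⌋₊ ≤ ⌊2 ^ (k + 1) * x⌋₊ := by
      refine Nat.le_floor ?_
      push_cast
      have := Nat.floor_le h2x
      rw [pow_succ]
      linarith
    have h2 : ⌊2 ^ (k + 1) * x⌋₊ ≤ 2 * ⌊2 ^ k * x⌋₊ + 1 := by
      refine Nat.lt_succ_iff.1 ((Nat.floor_lt (mul_nonneg (by positivity) hx.1)).2 ?_)
      push_cast
      have := Nat.lt_floor_add_one (2 ^ k * x)
      rw [pow_succ]
      linarith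
    rw [dist_comm, dist_eq_norm, e, mul_assoc, ← pow_succ']
    exact norm_sub_floor_le hB (k + 1) h1 h2 (hfl x hx _) (by positivity)
  have hlim : ∀ x ∈ Icc (0 : ℝ) 1,
      ‖f ((⌊2 ^ n * x⌋₊ : ℝ) / 2 ^ n) - f x‖ ≤ B * r * r ^ n / (1 - r) := by
    intro x hx
    rw [← dist_eq_norm]
    refine dist_le_of_le_geometric_of_tendsto r (B * r) hr (hstep x hx) ?_ n
    refine (hf x hx).tendsto.comp (tendsto_nhdsWithin_iff.2 ⟨tendsto_floor_two_pow_div hx.1, ?_⟩)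
    exact Eventually.of_forall fun k => floor_two_pow_div_mem k hx
  have hsI : s ∈ Icc (0 : ℝ) 1 := ⟨hs, hst.trans ht⟩
  have htI : t ∈ Icc (0 : ℝ) 1 := ⟨hs.trans hst, ht⟩
  have h2n : (0 : ℝ) < 2 ^ n := by positivity
  have hmid : ‖f ((⌊2 ^ n * t⌋₊ : ℝ) / 2 ^ n) - f ((⌊2 ^ n * s⌋₊ : ℝ) / 2 ^ n)‖ ≤ B * r ^ n := by
    refine norm_sub_floor_le hB n (Nat.floor_le_floor (by gcongr)) ?_ (hfl t htI n) (by positivity)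
    refine Nat.lt_succ_iff.1 ((Nat.floor_lt (mul_nonneg h2n.le htI.1)).2 ?_)
    have h1 := Nat.lt_floor_add_one (2 ^ n * s)
    have h2 : 2 ^ n * (t - s) ≤ 1 := by
      calc 2 ^ n * (t - s) ≤ 2 ^ n * (1 / 2) ^ n := by gcongr
        _ = 1 := by rw [← mul_pow]; norm_num
    push_cast
    linarith
  have hS := hlim s hsI
  have hT := hlim t htI
  rw [norm_sub_rev] at hT
  have hrn : 0 ≤ B * r ^ n := by positivity
  calc ‖f t - f s‖ ≤ B * r * r ^ n / (1 - r) + B * r ^ n + B * r * r ^ n / (1 - r) := by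
        have e : f t - f s = (f t - f ((⌊2 ^ n * t⌋₊ : ℝ) / 2 ^ n)) +
          (f ((⌊2 ^ n * t⌋₊ : ℝ) / 2 ^ n) - f ((⌊2 ^ n * s⌋₊ : ℝ) / 2 ^ n)) +
          (f ((⌊2 ^ n * s⌋₊ : ℝ) / 2 ^ n) - f s) := by abel
        rw [e]
        exact (norm_add₃_le).trans (by gcongr)
    -- The two tails and the middle step add up to `(1 + r) / (1 - r)` times `B * r ^ n`; the
    -- constant `3` is not sharp.
    _ ≤ 3 * B / (1 - r) * r ^ n := by
        have e : B * r * r ^ n / (1 - r) + B * r ^ n + B * r * r ^ n / (1 - r) =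
          (1 + r) * (B * r ^ n) / (1 - r) := by field_simp; ring
        rw [e, div_mul_eq_mul_div, mul_assoc 3 B]
        gcongr
        linarith

theorem holder_of_dyadic {η : ℝ} (hη : 0 < η) (hf : ContinuousOn f (Icc 0 1)) (hB0 : 0 ≤ B)
    (hB : ∀ n k : ℕ, k < 2 ^ n →
      ‖f ((k + 1 : ℕ) / 2 ^ n) - f ((k : ℕ) / 2 ^ n)‖ ≤ B * ((1 / 2 : ℝ) ^ η) ^ n) :
    ∃ C, 0 ≤ C ∧ ∀ s ∈ Icc (0 : ℝ) 1, ∀ t ∈ Icc (0 : ℝ) 1, ‖f t - f s‖ ≤ C * |t - s| ^ η := by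
  set r := (1 / 2 : ℝ) ^ η with hr
  have hr0 : 0 < r := by positivity
  have hr1 : r < 1 := Real.rpow_lt_one (by norm_num) (by norm_num) hη
  have hD : 0 ≤ 3 * B / (1 - r) := div_nonneg (by positivity) (by linarith)
  refine ⟨3 * B / (1 - r) / r, by positivity, ?_⟩
  have key : ∀ s ∈ Icc (0 : ℝ) 1, ∀ t ∈ Icc (0 : ℝ) 1, s < t →
      ‖f t - f s‖ ≤ 3 * B / (1 - r) / r * |t - s| ^ η := by
    intro s hs t ht hst
    -- The scale is `(1/2)^(n+1) < t - s ≤ (1/2)^n`. The lower bound gives `r^(n+1) ≤ (t - s)^η`,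
    -- which explains the extra division by `r` in the constant.
    obtain ⟨n, hn1, hn2⟩ := exists_nat_pow_near_of_lt_one (sub_pos.2 hst)
      (by linarith [hs.1, ht.2]) (by norm_num : (0 : ℝ) < 1 / 2) (by norm_num)
    refine (norm_sub_le_of_dyadic hf hB0 hr0.le hr1 hB n hs.1 hst.le ht.2 hn2).trans ?_
    rw [div_mul_eq_mul_div (3 * B / (1 - r)) r, mul_div_assoc (3 * B / (1 - r))]
    refine mul_le_mul_of_nonneg_left ?_ hD
    rw [le_div_iff₀ hr0, ← pow_succ, abs_of_pos (sub_pos.2 hst), hr, ← Real.rpow_natCast,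
      ← Real.rpow_mul (by norm_num), mul_comm, Real.rpow_mul (by norm_num), Real.rpow_natCast]
    exact Real.rpow_le_rpow (by positivity) hn1.le hη.le
  intro s hs t ht
  rcases lt_trichotomy s t with h | rfl | h
  · exact key s hs t ht h
  · simp [Real.zero_rpow hη.ne']
  · rw [norm_sub_rev, abs_sub_comm]
    exact key t ht s hs h

theorem memHolder_of_dyadic {η : ℝ≥0} (hη : 0 < η) {T : ℝ} (hT : 0 < T)
    (hf : ContinuousOn f (Icc 0 T)) (hB0 : 0 ≤ B)
    (hB : ∀ n k : ℕ, k < 2 ^ n →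
      ‖f (T * ((k + 1 : ℕ) / 2 ^ n)) - f (T * ((k : ℕ) / 2 ^ n))‖ ≤
        B * ((1 / 2 : ℝ) ^ (η : ℝ)) ^ n) :
    MemHolder η (fun t : Icc (0 : ℝ) T => f t) := by
  have hc : ContinuousOn (fun x => f (T * x)) (Icc 0 1) := by
    refine hf.comp (by fun_prop) fun x hx => ⟨by have := hx.1; positivity, ?_⟩
    exact mul_le_of_le_one_right hT.le hx.2
  obtain ⟨C, hC0, hC⟩ := holder_of_dyadic (NNReal.coe_pos.2 hη) hc hB0 hB
  refine ⟨(C / T ^ (η : ℝ)).toNNReal, fun s t => ?_⟩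
  have hI : ∀ u : Icc (0 : ℝ) T, (u : ℝ) / T ∈ Icc (0 : ℝ) 1 := fun u =>
    ⟨div_nonneg u.2.1 hT.le, (div_le_one hT).2 u.2.2⟩
  have h := hC _ (hI t) _ (hI s)
  simp only [mul_div_cancel₀ _ hT.ne'] at h
  rw [← sub_div, abs_div, abs_of_pos hT, Real.div_rpow (abs_nonneg _) hT.le] at h
  rw [edist_dist, edist_dist, Subtype.dist_eq, dist_eq_norm, Real.dist_eq,
    ENNReal.ofReal_rpow_of_nonneg (abs_nonneg _) η.coe_nonneg]
  change _ ≤ ENNReal.ofReal (C / T ^ (η : ℝ)) * _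
  rw [← ENNReal.ofReal_mul (by positivity)]
  exact ENNReal.ofReal_le_ofReal (h.trans (le_of_eq (by ring)))

end Dyadic

/-! ### Moments of Gaussian vectors and Hölder continuity of the Wiener process -/

/-- `N(0, v)` is the law of `√v` times a standard normal variable. Linearity in `v` lets the
coordinate bounds add up to a trace. -/
theorem eLpNorm_sq_gaussianReal (p : ℝ≥0∞) (v : ℝ≥0) :
    eLpNorm (fun x : ℝ => x ^ 2) p (gaussianReal 0 v) =
      v * eLpNorm (fun x : ℝ => x ^ 2) p (gaussianReal 0 1) := by
  have h := gaussianReal_map_const_mul (μ := 0) (v := 1) (√v)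
  have e : (.mk (√(v : ℝ) ^ 2) (sq_nonneg _) * 1 : ℝ≥0) = v := by
    ext; simp
  rw [mul_zero, e] at h
  rw [← h, eLpNorm_map_measure (by fun_prop) (by fun_prop)]
  have e2 : ((fun x : ℝ => x ^ 2) ∘ fun x => √(v : ℝ) * x) = (v : ℝ) • fun x : ℝ => x ^ 2 := by
    ext x
    simp [mul_pow]
  rw [e2, eLpNorm_const_smul]
  simp

theorem eLpNorm_sq_gaussianReal_lt_top (p : ℝ≥0) :
    eLpNorm (fun x : ℝ => x ^ 2) p (gaussianReal 0 1) < ∞ := by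
  have h := (memLp_id_gaussianReal (μ := 0) (v := 1) (2 * p)).norm_rpow_div 2
  have e : ((2 * p : ℝ≥0) : ℝ≥0∞) / 2 = p := by
    push_cast
    rw [mul_comm, ENNReal.mul_div_cancel_right (by norm_num) (by norm_num)]
  rw [e] at h
  refine lt_of_eq_of_lt (eLpNorm_congr_norm_ae (ae_of_all _ fun x => ?_)) h.2
  simp

section Moments

variable {Ω H : Type*} {mΩ : MeasurableSpace Ω} {P : Measure Ω} [NormedAddCommGroup H]
  [InnerProductSpace ℝ H]

/-- The `L^p` norm of `‖X‖²`, for a Gaussian random vector `X` with summable variances along an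
orthonormal basis. -/
theorem eLpNorm_norm_sq_le_of_gaussian (e : HilbertBasis ℕ ℝ H) {X : Ω → H}
    (hX : AEStronglyMeasurable X P) {q : ℕ → ℝ≥0}
    (hlaw : ∀ n, P.map (fun ω => inner ℝ (e n) (X ω)) = gaussianReal 0 (q n)) {p : ℝ≥0∞}
    (hp : 1 ≤ p) :
    eLpNorm (fun ω => ‖X ω‖ ^ 2) p P ≤
      (∑' n, (q n : ℝ≥0∞)) * eLpNorm (fun x : ℝ => x ^ 2) p (gaussianReal 0 1) := by
  have hm : ∀ n, AEStronglyMeasurable (fun ω => inner ℝ (e n) (X ω) : Ω → ℝ) P := fun n =>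
    hX.const_inner
  have hlim : ∀ ω, Tendsto (fun N => (∑ n ∈ Finset.range N, fun ω => inner ℝ (e n) (X ω) ^ 2 :
      Ω → ℝ) ω) atTop (𝓝 (‖X ω‖ ^ 2)) := by
    intro ω
    have h := (e.hasSum_inner_mul_inner (X ω) (X ω)).tendsto_sum_nat
    rw [real_inner_self_eq_norm_sq] at h
    refine h.congr fun N => ?_
    rw [Finset.sum_apply]
    refine Finset.sum_congr rfl fun n _ => ?_
    rw [real_inner_comm, sq]
  -- Fatou for the partial sums in Parseval's identity, then Minkowski; no independence of the
  -- coordinates is needed.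
  refine (Lp.eLpNorm_lim_le_liminf_eLpNorm (fun N => ?_) _ (ae_of_all _ hlim)).trans ?_
  · exact Finset.aestronglyMeasurable_sum _ fun n _ => (hm n).pow 2
  refine liminf_le_of_le (by isBoundedDefault) fun b hb => ?_
  obtain ⟨N, hN⟩ := hb.exists
  refine hN.trans ((eLpNorm_sum_le (fun n _ => (hm n).pow 2) hp).trans ?_)
  rw [← ENNReal.tsum_mul_right]
  refine le_trans (le_of_eq (Finset.sum_congr rfl fun n _ => ?_))
    (ENNReal.sum_le_tsum (Finset.range N))
  rw [← eLpNorm_sq_gaussianReal, ← hlaw n, eLpNorm_map_measure (by fun_prop) (hm n).aemeasurable]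
  rfl

end Moments

/-- The coordinates of an increment have variances `(t - s) ⟨Q eₙ, eₙ⟩`, so `M` is the trace of `Q`
times an `L^p` norm of a squared standard normal. The power `(t - s)^p` is what later beats the
number of dyadic intervals. -/
theorem NeuralField.IsQWiener.exists_lintegral_le {Ω : Type*} {mΩ : MeasurableSpace Ω} {P : Measure Ω}
    {ℱ : Filtration ℝ mΩ} {T : ℝ} {Q : L2 →L[ℝ] L2} {W : ℝ → Ω → L2} (hQ : IsCovariance Q)
    (hW : IsQWiener P ℱ T Q W) {p : ℕ} (hp : 1 ≤ p) :
    ∃ M : ℝ≥0∞, M ≠ ∞ ∧ ∀ s t, 0 ≤ s → s ≤ t → t ≤ T →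
      ∫⁻ ω, ‖W t ω - W s ω‖ₑ ^ (2 * p) ∂P ≤ (ENNReal.ofReal (t - s) * M) ^ p := by
  obtain ⟨e, he⟩ := hQ.trace
  set q : ℕ → ℝ≥0 := fun n => (inner ℝ (Q (e n)) (e n)).toNNReal with hq
  have hsum : ∑' n, (q n : ℝ≥0∞) ≠ ∞ := ENNReal.tsum_coe_ne_top_iff_summable.2 he.toNNReal
  refine ⟨(∑' n, (q n : ℝ≥0∞)) * eLpNorm (fun x : ℝ => x ^ 2) p (gaussianReal 0 1),
    ENNReal.mul_ne_top hsum (eLpNorm_sq_gaussianReal_lt_top p).ne, fun s t hs hst ht => ?_⟩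
  have hm : ∀ r ∈ Icc 0 T, StronglyMeasurable (W r) := fun r hr =>
    (hW.adapted r hr).mono (ℱ.le r)
  have hX : StronglyMeasurable (fun ω => W t ω - W s ω) :=
    (hm t ⟨hs.trans hst, ht⟩).sub (hm s ⟨hs, hst.trans ht⟩)
  have hlaw : ∀ n, P.map (fun ω => inner ℝ (e n) (W t ω - W s ω)) =
      gaussianReal 0 ((t - s).toNNReal * q n) := fun n => by
    rw [hW.gaussian s t hs hst ht, Real.toNNReal_mul (sub_nonneg.2 hst)]
  have h := eLpNorm_norm_sq_le_of_gaussian e hX.aestronglyMeasurable hlaw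
    (p := p) (by exact_mod_cast hp)
  simp only [ENNReal.coe_mul, ENNReal.tsum_mul_left] at h
  rw [mul_assoc] at h
  have hp0 : (p : ℝ≥0∞) ≠ 0 := by exact_mod_cast (by omega : p ≠ 0)
  rw [eLpNorm_eq_lintegral_rpow_enorm_toReal hp0 (ENNReal.natCast_ne_top p)] at h
  have hp1 : (0 : ℝ) < p := by exact_mod_cast hp
  rw [ENNReal.toReal_natCast, one_div, ENNReal.rpow_inv_le_iff hp1] at h
  simpa [pow_mul, ENNReal.ofReal] using h

/-- Summability of the dyadic moments gives a random Hölder constant on the dyadic points. -/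
theorem NeuralField.IsQWiener.ae_exists_dyadic_bound {Ω : Type*} {mΩ : MeasurableSpace Ω} {P : Measure Ω}
    {ℱ : Filtration ℝ mΩ} {T : ℝ} (hT : 0 < T) {Q : L2 →L[ℝ] L2} {W : ℝ → Ω → L2}
    (hQ : IsCovariance Q) (hW : IsQWiener P ℱ T Q W) {η : ℝ} (hη' : η < 1 / 2) :
    ∀ᵐ ω ∂P, ∃ B : ℝ, 0 ≤ B ∧ ∀ n k : ℕ, k < 2 ^ n →
      ‖W (T * ((k + 1 : ℕ) / 2 ^ n)) ω - W (T * ((k : ℕ) / 2 ^ n)) ω‖ ≤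
        B * ((1 / 2 : ℝ) ^ η) ^ n := by
  set r := (1 / 2 : ℝ) ^ η with hr
  have hr0 : 0 < r := by positivity
  -- Level `n` has `2^n` increments, with moments of order `2^(-np)` and weights `2^(2pηn)`; the
  -- product decays geometrically exactly when `p (1 - 2η) > 1`.
  obtain ⟨p, hp1, hp2⟩ : ∃ p : ℕ, 1 ≤ p ∧ 1 / (1 - 2 * η) < p := by
    obtain ⟨p, hp⟩ := exists_nat_gt (max 1 (1 / (1 - 2 * η)))
    refine ⟨p, ?_, (le_max_right _ _).trans_lt hp⟩
    exact_mod_cast ((le_max_left _ _).trans_lt hp).le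
  obtain ⟨M, hM, hmom⟩ := hW.exists_lintegral_le hQ hp1
  set D : ℕ → ℕ → Ω → L2 := fun n k ω =>
    W (T * ((k + 1 : ℕ) / 2 ^ n)) ω - W (T * ((k : ℕ) / 2 ^ n)) ω with hD
  -- The ratio of the geometric series.
  set θ : ℝ := 2 * (1 / 2) ^ p / r ^ (2 * p) with hθ
  have hθ0 : 0 ≤ θ := by positivity
  have hθ1 : θ < 1 := by
    have e : θ = (1 / 2 : ℝ) ^ (-1 + p - η * (2 * p) : ℝ) := by
      rw [hθ, Real.rpow_sub (by norm_num), Real.rpow_add (by norm_num), Real.rpow_neg_one,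
        Real.rpow_natCast, Real.rpow_mul (by norm_num), ← hr]
      norm_num
      norm_cast
    rw [e]
    refine Real.rpow_lt_one (by norm_num) (by norm_num) ?_
    rw [div_lt_iff₀ (by linarith)] at hp2
    linarith
  have hgrid : ∀ n k : ℕ, k ≤ 2 ^ n → T * ((k : ℕ) / 2 ^ n) ∈ Icc 0 T := fun n k hk => by
    refine ⟨by positivity, mul_le_of_le_one_right hT.le ?_⟩
    rw [div_le_one (by positivity)]
    exact_mod_cast hk
  have hmeas : ∀ n k, k < 2 ^ n → Measurable fun ω => ‖D n k ω‖ₑ := fun n k hk =>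
    (((hW.adapted _ (hgrid n (k + 1) hk)).mono (ℱ.le _)).sub
      ((hW.adapted _ (hgrid n k hk.le)).mono (ℱ.le _))).enorm
  have hbound : ∀ n k, k < 2 ^ n →
      ∫⁻ ω, ‖D n k ω‖ₑ ^ (2 * p) ∂P ≤ ENNReal.ofReal ((1 / 2) ^ p) ^ n * (ENNReal.ofReal T * M) ^ p := by
    intro n k hk
    refine (hmom _ _ (hgrid n k hk.le).1 ?_ (hgrid n (k + 1) hk).2).trans (le_of_eq ?_)
    · push_cast
      gcongr
      linarith
    · have e : T * ((k + 1 : ℕ) / 2 ^ n) - T * ((k : ℕ) / 2 ^ n) = (1 / 2) ^ n * T := by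
        push_cast
        rw [one_div, inv_pow]
        field_simp
        ring
      rw [e, ENNReal.ofReal_mul (by positivity), mul_assoc, mul_pow, ENNReal.ofReal_pow (by norm_num),
        ENNReal.ofReal_pow (by norm_num), ← pow_mul, ← pow_mul, mul_comm n p]
  -- `S` has finite expectation, hence is finite almost surely. Each single term is at most `S`,
  -- which bounds every increment by `S^(1/(2p)) * r^n`.
  set S : Ω → ℝ≥0∞ := fun ω => ∑' n, ∑ k ∈ Finset.range (2 ^ n),
    ‖D n k ω‖ₑ ^ (2 * p) * ENNReal.ofReal ((r ^ (2 * p))⁻¹ ^ n) with hS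
  have hSm : ∀ n, Measurable fun ω => ∑ k ∈ Finset.range (2 ^ n),
      ‖D n k ω‖ₑ ^ (2 * p) * ENNReal.ofReal ((r ^ (2 * p))⁻¹ ^ n) := fun n =>
    Finset.measurable_fun_sum _ fun k hk =>
      ((hmeas n k (Finset.mem_range.1 hk)).pow_const _).mul_const _
  have hSint : ∫⁻ ω, S ω ∂P ≤ (∑' n, ENNReal.ofReal θ ^ n) * (ENNReal.ofReal T * M) ^ p := by
    rw [hS, lintegral_tsum fun n => (hSm n).aemeasurable, ← ENNReal.tsum_mul_right]
    refine ENNReal.tsum_le_tsum fun n => ?_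
    rw [lintegral_finsetSum' _ fun k hk =>
      (((hmeas n k (Finset.mem_range.1 hk)).pow_const _).mul_const _).aemeasurable]
    calc ∑ k ∈ Finset.range (2 ^ n),
          ∫⁻ ω, ‖D n k ω‖ₑ ^ (2 * p) * ENNReal.ofReal ((r ^ (2 * p))⁻¹ ^ n) ∂P
        ≤ ∑ k ∈ Finset.range (2 ^ n), ENNReal.ofReal ((1 / 2) ^ p) ^ n *
            (ENNReal.ofReal T * M) ^ p * ENNReal.ofReal ((r ^ (2 * p))⁻¹ ^ n) := by
          refine Finset.sum_le_sum fun k hk => ?_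
          rw [lintegral_mul_const' _ _ ENNReal.ofReal_ne_top]
          gcongr
          exact hbound n k (Finset.mem_range.1 hk)
      _ = ENNReal.ofReal θ ^ n * (ENNReal.ofReal T * M) ^ p := by
          rw [Finset.sum_const, Finset.card_range, nsmul_eq_mul, hθ, div_eq_mul_inv _ (r ^ (2 * p)),
            ENNReal.ofReal_mul (by positivity), ENNReal.ofReal_mul (by positivity),
            ENNReal.ofReal_pow (by positivity : 0 ≤ (r ^ (2 * p))⁻¹)]
          push_cast
          rw [ENNReal.ofReal_ofNat]
          ring
  have hSfin : ∫⁻ ω, S ω ∂P ≠ ∞ := by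
    refine ne_top_of_le_ne_top (ENNReal.mul_ne_top ?_ ?_) hSint
    · rw [ENNReal.tsum_geometric]
      refine ENNReal.inv_ne_top.2 (tsub_pos_of_lt ?_).ne'
      exact ENNReal.ofReal_lt_one.2 hθ1
    · exact ENNReal.pow_ne_top (ENNReal.mul_ne_top ENNReal.ofReal_ne_top hM)
  filter_upwards [ae_lt_top' (AEMeasurable.tsum fun n => (hSm n).aemeasurable) hSfin] with ω hω
  have h2p : 2 * p ≠ 0 := by omega
  refine ⟨(S ω).toReal ^ (((2 * p : ℕ) : ℝ)⁻¹), by positivity, fun n k hk => ?_⟩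
  have h1 : ‖D n k ω‖ₑ ^ (2 * p) * ENNReal.ofReal ((r ^ (2 * p))⁻¹ ^ n) ≤ S ω :=
    (Finset.single_le_sum (f := fun k => ‖D n k ω‖ₑ ^ (2 * p) * ENNReal.ofReal ((r ^ (2 * p))⁻¹ ^ n))
      (fun _ _ => zero_le) (Finset.mem_range.2 hk)).trans
      (ENNReal.le_tsum (f := fun n => ∑ k ∈ Finset.range (2 ^ n),
        ‖D n k ω‖ₑ ^ (2 * p) * ENNReal.ofReal ((r ^ (2 * p))⁻¹ ^ n)) n)
  have h2 := ENNReal.toReal_mono hω.ne h1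
  rw [ENNReal.toReal_mul, ENNReal.toReal_pow, toReal_enorm, ENNReal.toReal_ofReal (by positivity)] at h2
  refine (pow_le_pow_iff_left₀ (norm_nonneg _) (by positivity) h2p).1 ?_
  rw [mul_pow, Real.rpow_inv_natCast_pow ENNReal.toReal_nonneg h2p, pow_right_comm r]
  rwa [inv_pow, ← div_eq_mul_inv, div_le_iff₀ (by positivity)] at h2

/-- Path continuity gives the supremum on the compact interval and also carries the Hölder bound
from the dyadic points to all times. -/
theorem NeuralField.IsQWiener.ae_holderNorm_lt_top {Ω : Type*} {mΩ : MeasurableSpace Ω} {P : Measure Ω}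
    {ℱ : Filtration ℝ mΩ} {T : ℝ} (hT : 0 < T) {Q : L2 →L[ℝ] L2} {W : ℝ → Ω → L2}
    (hQ : IsCovariance Q) (hW : IsQWiener P ℱ T Q W) {η : ℝ≥0} (hη : 0 < η) (hη' : η < 1 / 2) :
    ∀ᵐ ω ∂P, holderNorm η T (fun t => W t ω) < ∞ := by
  have hη2 : (η : ℝ) < 1 / 2 := by exact_mod_cast hη'
  filter_upwards [hW.continuous, hW.ae_exists_dyadic_bound hT hQ hη2] with ω hc ⟨B, hB0, hB⟩
  refine ENNReal.add_lt_top.2 ⟨?_, ?_⟩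
  · obtain ⟨M, hM⟩ := isCompact_Icc.exists_bound_of_continuousOn hc
    refine lt_of_le_of_lt (iSup₂_le fun t ht => ?_) (ENNReal.ofReal_lt_top (r := M))
    rw [← ofReal_norm]
    exact ENNReal.ofReal_le_ofReal (hM t ht)
  · exact eHolderNorm_lt_top.2 (memHolder_of_dyadic (f := fun t => W t ω) hη hT hc hB0 hB)

/-! ### The pathwise bound -/

/-- A path perturbed by a forcing term bounded by `ξ` stays in a ball of radius proportional to `ξ`,
if the linear drift is dissipative and of linear growth. -/
theorem norm_le_of_dissipative {E : Type*} [NormedAddCommGroup E]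
    [InnerProductSpace ℝ E] [CompleteSpace E] {T κ L ξ : ℝ} (hκ : 0 < κ) (hL : 0 ≤ L)
    {A : ℝ → E → E} (hAL : ∀ s ∈ Icc 0 T, ∀ z, ‖A s z‖ ≤ L * ‖z‖)
    (hAκ : ∀ s ∈ Icc 0 T, ∀ z, inner ℝ (A s z) z ≤ -κ * ‖z‖ ^ 2) {z ζ : ℝ → E}
    (hζ : ContinuousOn ζ (Icc 0 T)) (hζξ : ∀ s ∈ Icc 0 T, ‖ζ s‖ ≤ ξ)
    (hint : IntervalIntegrable (fun s => A s (z s)) volume 0 T)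
    (heq : ∀ t ∈ Icc 0 T, z t = (∫ s in (0 : ℝ)..t, A s (z s)) + ζ t) :
    ∀ t ∈ Icc 0 T, ‖z t‖ ≤ (2 + L / κ) * ξ := by
  intro t ht
  have hT : 0 ≤ T := ht.1.trans ht.2
  have hξ : 0 ≤ ξ := (norm_nonneg _).trans (hζξ t ht)
  have hzc : ContinuousOn z (Icc 0 T) := by
    have h1 := intervalIntegral.continuousOn_primitive_interval'
      hint (left_mem_uIcc : (0 : ℝ) ∈ uIcc 0 T)
    rw [uIcc_of_le hT] at h1
    exact (h1.add hζ).congr heq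
  -- `M` depends on the path. It only makes the integrand bounded and does not enter the final
  -- radius.
  obtain ⟨M, hM⟩ := isCompact_Icc.exists_bound_of_continuousOn hzc
  have key := norm_integral_le_of_inner_nonpos (R := (1 + L / κ) * ξ) (G := L * M)
    (by positivity) hint
    (fun s hs => (hAL s hs _).trans (mul_le_mul_of_nonneg_left (hM s hs) hL)) ?_ t ht
  · rw [heq t ht]
    refine (norm_add_le _ _).trans ((add_le_add key (hζξ t ht)).trans (le_of_eq (by ring)))
  · intro s hs hlt
    have e : (∫ r in (0 : ℝ)..s, A r (z r)) = z s - ζ s := by rw [heq s hs, add_sub_cancel_right]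
    rw [e] at hlt ⊢
    have hz : L / κ * ξ ≤ ‖z s‖ := by
      have := norm_sub_le (z s) (ζ s)
      have := hζξ s hs
      linarith
    have hz' : L * ξ ≤ κ * ‖z s‖ := by
      rw [div_mul_eq_mul_div, div_le_iff₀ hκ] at hz
      linarith
    rw [real_inner_comm, inner_sub_right]
    have h1 := hAκ s hs (z s)
    have h2 : -(inner ℝ (A s (z s)) (ζ s) : ℝ) ≤ L * ‖z s‖ * ξ := by
      refine (neg_le_abs _).trans ((abs_real_inner_le_norm _ _).trans ?_)
      exact mul_le_mul (hAL s hs _) (hζξ s hs) (norm_nonneg _) (by positivity)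
    -- The inner product is at most `-‖z‖ (κ ‖z‖ - L ξ)`, and `hz'` gives the sign of the bracket.
    nlinarith [mul_nonneg (norm_nonneg (z s)) (sub_nonneg.2 hz')]

/-- Passes from real bounds to extended suprema: an infinite right-hand side is trivial because `K >
0`, and otherwise the supremum itself serves as `ξ`. -/
theorem iSup_enorm_le_of_forall {E : Type*} [NormedAddCommGroup E] {S : Set ℝ} {f g : ℝ → E}
    {K : ℝ≥0} (hK : 0 < K)
    (h : ∀ ξ : ℝ, (∀ t ∈ S, ‖g t‖ ≤ ξ) → ∀ t ∈ S, ‖f t‖ ≤ K * ξ) :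
    (⨆ t ∈ S, ‖f t‖ₑ) ≤ K * ⨆ t ∈ S, ‖g t‖ₑ := by
  by_cases htop : (⨆ t ∈ S, ‖g t‖ₑ) = ∞
  · rw [htop, ENNReal.mul_top (by exact_mod_cast hK.ne')]
    exact le_top
  refine iSup₂_le fun t ht => ?_
  have h1 := h (⨆ t ∈ S, ‖g t‖ₑ).toReal (fun s hs => by
    rw [← toReal_enorm]
    exact ENNReal.toReal_mono htop (le_iSup₂ (f := fun t (_ : t ∈ S) => ‖g t‖ₑ) s hs)) t ht
  calc ‖f t‖ₑ = ENNReal.ofReal ‖f t‖ := (ofReal_norm _).symm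
    _ ≤ ENNReal.ofReal (K * (⨆ t ∈ S, ‖g t‖ₑ).toReal) := ENNReal.ofReal_le_ofReal h1
    _ = K * ⨆ t ∈ S, ‖g t‖ₑ := by
      rw [ENNReal.ofReal_mul K.coe_nonneg, ENNReal.ofReal_coe_nnreal, ENNReal.ofReal_toReal htop]

theorem mainTheorem6 (κ : ℝ) (hκ : 0 < κ) (η : ℝ≥0) (hη : 0 < η) (hη' : η < 1 / 2)
    (LF : ℝ) (GU : ℝ) (m : ℝ) (hm : 0 < m) :
    ∃ K : ℝ≥0, 0 < K ∧
      ∀ {Ω : Type*} [mΩ : MeasurableSpace Ω] (P : Measure Ω) [IsProbabilityMeasure P]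
        (ℱ : Filtration ℝ mΩ) (T : ℝ) (_ : 0 < T)
        (Q : L2 →L[ℝ] L2) (_ : IsCovariance Q)
        (W : ℝ → Ω → L2) (_ : IsQWiener P ℱ T Q W),
        (∀ᵐ ω ∂P, holderNorm η T (fun t => W t ω) < ∞) ∧
        ∀ (ε : ℝ) (_ : 0 < ε)
          (w F U : ℝ → ℝ) (c : ℝ) (_ : IsKernel w) (_ : IsGain F) (_ : IsTravellingWave w F c U)
          (_ : (⨆ x, |deriv F x|) = LF) (_ : ‖grad U 0‖ = GU)
          (v₀ : L2) (v : ℝ → Ω → L2) (_ : IsFluctuation P ℱ T w F U c ε v₀ W v)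
          (C : ℝ → Ω → ℝ) (_ : IsPhase P T U c m v C)
          (Cstar : ℝ) (_ : 0 < Cstar) (_ : Cstar < m)
          (_ : ∀ᵐ ω ∂P, ∀ t ∈ Icc 0 T, ∀ z : L2,
            inner ℝ (opA0 w F U (c * t + C t ω) z) z ≤
              -κ * ‖z‖ ^ 2 + Cstar * (inner ℝ (grad U (c * t + C t ω)) z) ^ 2)
          (Z : ℝ → Ω → L2) (_ : IsOrnsteinUhlenbeck P ℱ T w F U c m C W Z),
          ∀ᵐ ω ∂P, (⨆ t ∈ Icc 0 T, ‖Z t ω‖ₑ) ≤ K * holderNorm η T (fun t => W t ω) := by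
  -- `LF` is fixed before `F`, so its sign is unknown here; the absolute value keeps `K` positive.
  have hL : 0 ≤ 1 + |LF| + m * GU ^ 2 := by positivity
  obtain ⟨K, hK⟩ : ∃ K : ℝ≥0, (K : ℝ) = 2 + (1 + |LF| + m * GU ^ 2) / κ :=
    CanLift.prf (β := ℝ≥0) (2 + (1 + |LF| + m * GU ^ 2) / κ) (by positivity)
  have hK0 : 0 < K := by
    rw [← NNReal.coe_pos, hK]
    positivity
  refine ⟨K, hK0, ?_⟩
  intro Ω mΩ P _ ℱ T hT Q hQ W hW
  refine ⟨hW.ae_holderNorm_lt_top hT hQ hη hη', ?_⟩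
  intro ε _ w F U c hw hF hU hLF hGU v₀ v _ C _ Cstar _ hCm hdiss Z hZ
  filter_upwards [hW.continuous, hdiss, hZ.integrable, hZ.equation] with ω hc hA hint heq
  -- The Hölder seminorm is dropped: the supremum of `W` suffices.
  refine (iSup_enorm_le_of_forall hK0 fun ξ hξ => ?_).trans (mul_le_mul_right le_self_add _)
  rw [hK]
  refine norm_le_of_dissipative (A := fun s => opA w F U m (c * s + C s ω)) hκ hL
    (fun s _ z => ?_) (fun s hs z => inner_opA_le hCm.le (hA s hs z)) hc hξ hint heq
  refine (norm_opA_le hw hF hU hm.le _ z).trans ?_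
  rw [hLF, hGU]
  gcongr
  exact le_abs_self _
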